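/- Let $d>2$ and $n\ge 1$ be integers. Equip $\mathbb C^n$ with its Euclidean inner product and $\bigotimes^d\mathbb C^n$ with the sesquilinear inner product determined by $\langle y_1\otimes\cdots\otimes y_d,\;x_1\otimes\cdots\otimes x_d\rangle=\prod_{i=1}^d\langle y_i,x_i\rangle$, and let $\operatorname{HS}(\mathbf z)=\sqrt{\langle\mathbf z,\mathbf z\rangle}$ be the associated Hilbert–Schmidt norm. The tensor rank of $\mathbf y\in\bigotimes^d\mathbb C^n$ is the least $r\in\{0,1,2,\dots\}$ such that $\mathbf y$ is a sum of $r$ elementary tensors $y_1\otimes\cdots\otimes y_d$; a best tensor rank-$1$ approximation of $\mathbf z$ is a tensor $\mathbf x$ of rank at most $1$ with $\operatorname{HS}(\mathbf z-\mathbf x)\le\operatorname{HS}(\mathbf z-\mathbf y)$ for every tensor $\mathbf y$ of rank at most $1$. Let $\mathbf z\in\bigotimes^d\mathbb C^n$ be a symmetric tensor (invariant under all permutations of the $d$ tensor factors) and let $\mathbf x=x_1\otimes\cdots\otimes x_d$, with $x_1,\dots,x_d\in\mathbb C^n$, be a best tensor rank-$1$ approximation of $\mathbf z$. Then $\mathbf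 x$ is symmetric, and if $\mathbf z\neq 0$ then $$\dim\operatorname{span}\{x_1,\dots,x_d\}=1 .$$ -/

import Mathlib

open scoped TensorProduct

noncomputable section

/-- The tensor product `⊗^d ℂⁿ`, where `ℂⁿ` carries the Euclidean norm. -/
abbrev TensorSpace (d n : ℕ) : Type :=
  ⨂[ℂ] _ : Fin d, EuclideanSpace ℂ (Fin n)

/-- The elementary tensor `x₁ ⊗ ⋯ ⊗ x_d`. -/
def elementaryTensor {d n : ℕ} (x : Fin d → EuclideanSpace ℂ (Fin n)) : TensorSpace d n :=
  PiTensorProduct.tprod ℂ x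

/-- A tensor is symmetric if it is fixed by every permutation of the `d` tensor factors. -/
def IsSymmetricTensor {d n : ℕ} (z : TensorSpace d n) : Prop :=
  ∀ η : Equiv.Perm (Fin d),
    PiTensorProduct.reindex ℂ (fun _ : Fin d => EuclideanSpace ℂ (Fin n)) η z = z

/-- The basis `e_{p 1} ⊗ ⋯ ⊗ e_{p d}` of `⊗^d ℂⁿ`. -/
def tensorBasis (d n : ℕ) : Module.Basis (Fin d → Fin n) ℂ (TensorSpace d n) :=
  Basis.piTensorProduct fun _ : Fin d => (EuclideanSpace.basisFun (Fin n) ℂ).toBasis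

/-- The inner product of `⊗^d ℂⁿ` (conjugate linear in the first variable), in coordinates.
It is the sesquilinear form with `⟨y₁ ⊗ ⋯ ⊗ y_d, x₁ ⊗ ⋯ ⊗ x_d⟩ = ∏ᵢ ⟨yᵢ, xᵢ⟩`, see
`hsInner_elementaryTensor`. -/
def hsInner {d n : ℕ} : TensorSpace d n →ₗ⋆[ℂ] TensorSpace d n →ₗ[ℂ] ℂ :=
  LinearMap.mk₂'ₛₗ (starRingEnd ℂ) (RingHom.id ℂ)
    (fun y x => ∑ p : Fin d → Fin n,
      starRingEnd ℂ ((tensorBasis d n).repr y p) * (tensorBasis d n).repr x p)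
    (fun y y' x => by simp [add_mul, Finset.sum_add_distrib])
    (fun c y x => by simp [Finset.mul_sum, mul_assoc])
    (fun y x x' => by simp [mul_add, Finset.sum_add_distrib])
    (fun c y x => by simp [Finset.mul_sum, mul_left_comm])

theorem hsInner_elementaryTensor {d n : ℕ} (y x : Fin d → EuclideanSpace ℂ (Fin n)) :
    hsInner (elementaryTensor y) (elementaryTensor x) = ∏ i, inner ℂ (y i) (x i) := by
  simp only [hsInner, elementaryTensor, tensorBasis, LinearMap.mk₂'ₛₗ_apply,
    Basis.piTensorProduct_repr_tprod_apply, PiLp.inner_apply, map_prod,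
    ← Finset.prod_mul_distrib, Finset.prod_univ_sum, Fintype.piFinset_univ]
  refine Finset.sum_congr rfl fun p _ => Finset.prod_congr rfl fun i _ => ?_
  simp [mul_comm]

/-- The Hilbert–Schmidt norm `HS(z) = √⟨z, z⟩`. -/
def hsNorm {d n : ℕ} (z : TensorSpace d n) : ℝ :=
  Real.sqrt (hsInner z z).re

/-- The tensor rank: the least `r` such that `z` is a sum of `r` elementary tensors. -/
def tensorRank {d n : ℕ} (z : TensorSpace d n) : ℕ :=
  sInf {r : ℕ | ∃ x : Fin r → Fin d → EuclideanSpace ℂ (Fin n),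
    z = ∑ j, elementaryTensor (x j)}

/-- For `d ≥ 1` the infimum in `tensorRank` is a minimum over a nonempty set. -/
theorem exists_sum_elementaryTensor {d n : ℕ} [NeZero d] (z : TensorSpace d n) :
    ∃ r : ℕ, ∃ x : Fin r → Fin d → EuclideanSpace ℂ (Fin n),
      z = ∑ j, elementaryTensor (x j) := by
  induction z using PiTensorProduct.induction_on with
  | smul_tprod c f =>
    refine ⟨1, fun _ => Function.update f 0 (c • f 0), ?_⟩
    simp [elementaryTensor, MultilinearMap.map_update_smul]
  | add a b ha hb =>
    obtain ⟨r, x, rfl⟩ := ha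
    obtain ⟨s, y, rfl⟩ := hb
    exact ⟨r + s, Fin.append x y, by simp [Fin.sum_univ_add]⟩

/-- `x` is a best tensor rank-`r` approximation of `z` for the Hilbert–Schmidt norm: it has the
least distance to `z` among all tensors of rank at most `r`. -/
def IsBestRankApprox {d n : ℕ} (r : ℕ) (z x : TensorSpace d n) : Prop :=
  tensorRank x ≤ r ∧ ∀ y : TensorSpace d n, tensorRank y ≤ r → hsNorm (z - x) ≤ hsNorm (z - y)

end

/-! ### Maximizers of symmetric trilinear forms on a complex inner product space. -/

section SymmetricTrilinear

variable {E : Type*} [NormedAddCommGroup E] [InnerProductSpace ℂ E]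

/-! Optimality along lines makes `M = ∏ ‖x i‖` the maximum of `|⟨z, ·⟩|` on products of unit
vectors, attained at the normalized factors of `x`. Freezing all slots but three and dividing by `M`
gives a contractive symmetric trilinear form `f` with `f w x y = 1` at three of these unit factors,
so it suffices that `x` and `y` are proportional (`IsContractiveSymmTrilinear.exists_smul_eq`).

By equality in Cauchy–Schwarz, a maximizer represents the partial functionals of `f`; hence `(w, x +
a y, y + ā x)` also attains the bound (`pair_eq`). Real `a = ±1` gives diagonal maximizers: `f w u u
= ‖u‖²` for `u = x + y` and `u = i (x - y)`. This forces `w` to be a multiple of each nonzero such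
`u` (`exists_smul_eq_of_diag`), so `x + y` and `x - y` are parallel. -/

/-- A symmetric trilinear form of spectral norm at most one. -/
structure IsContractiveSymmTrilinear (f : E → E → E → ℂ) : Prop where
  add : ∀ a a' b c, f (a + a') b c = f a b c + f a' b c
  smul : ∀ (s : ℂ) a b c, f (s • a) b c = s * f a b c
  swap_left : ∀ a b c, f a b c = f b a c
  swap_right : ∀ a b c, f a b c = f a c b
  norm_le : ∀ a b c, ‖f a b c‖ ≤ ‖a‖ * ‖b‖ * ‖c‖

/-- A functional attaining its norm bound at a unit vector is represented by that vector. -/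
theorem eq_inner_of_attains_bound [FiniteDimensional ℂ E] (g : E →ₗ[ℂ] ℂ) (w : E) (K : ℝ)
    (hw : ‖w‖ = 1) (hK : 0 ≤ K) (hg : ∀ v, ‖g v‖ ≤ K * ‖v‖) (hgw : g w = K) (v : E) :
    g v = K * inner ℂ w v := by
  have : CompleteSpace E := FiniteDimensional.complete ℂ E
  set G : E →L[ℂ] ℂ := LinearMap.toContinuousLinearMap g with hG
  set a := (InnerProductSpace.toDual ℂ E).symm G with ha
  have hga : ∀ v, inner ℂ a v = g v := fun v => by
    rw [ha, InnerProductSpace.toDual_symm_apply]; rfl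
  have hna : ‖a‖ ≤ K := by
    rw [ha, LinearIsometryEquiv.norm_map]
    exact ContinuousLinearMap.opNorm_le_bound _ hK hg
  -- Since `⟨a, w⟩ = K`, the square expands to `‖a‖² - 2K² + K²`.
  have h0 : ‖a - (K : ℂ) • w‖ ^ 2 ≤ 0 := by
    rw [@norm_sub_sq ℂ, inner_smul_right, hga, hgw, norm_smul, hw]
    simp only [RCLike.re_to_complex, Complex.norm_real, mul_one, Real.norm_eq_abs, sq_abs,
      ← Complex.ofReal_mul, Complex.ofReal_re]
    nlinarith [norm_nonneg a]
  have h1 : a = (K : ℂ) • w := by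
    rw [← sub_eq_zero, ← norm_eq_zero]
    exact pow_eq_zero_iff two_ne_zero |>.1 (le_antisymm h0 (sq_nonneg _))
  rw [← hga, h1, inner_smul_left, Complex.conj_ofReal]

namespace IsContractiveSymmTrilinear

variable {f : E → E → E → ℂ}

theorem eq_inner [FiniteDimensional ℂ E] (hf : IsContractiveSymmTrilinear f) {a b w : E}
    (hw : ‖w‖ = 1) (h : f w a b = ((‖a‖ * ‖b‖ : ℝ) : ℂ)) (v : E) :
    f v a b = ((‖a‖ * ‖b‖ : ℝ) : ℂ) * inner ℂ w v := by
  let g : E →ₗ[ℂ] ℂ :=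
    { toFun := fun v => f v a b
      map_add' := fun v v' => hf.add v v' a b
      map_smul' := fun s v => hf.smul s v a b }
  refine eq_inner_of_attains_bound g w _ hw (by positivity) (fun v => ?_) h v
  have := hf.norm_le v a b
  change ‖f v a b‖ ≤ _
  linarith

theorem rotate (hf : IsContractiveSymmTrilinear f) (a b c : E) : f a b c = f c a b := by
  rw [hf.swap_right, hf.swap_left]

theorem add_mid (hf : IsContractiveSymmTrilinear f) (a b b' c : E) :
    f a (b + b') c = f a b c + f a b' c := by
  rw [hf.swap_left, hf.add, hf.swap_left b, hf.swap_left b']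

theorem smul_mid (hf : IsContractiveSymmTrilinear f) (s : ℂ) (a b c : E) :
    f a (s • b) c = s * f a b c := by
  rw [hf.swap_left, hf.smul, hf.swap_left b]

theorem add_right (hf : IsContractiveSymmTrilinear f) (a b c c' : E) :
    f a b (c + c') = f a b c + f a b c' := by
  rw [hf.swap_right, hf.add_mid, hf.swap_right a c, hf.swap_right a c']

theorem smul_right (hf : IsContractiveSymmTrilinear f) (s : ℂ) (a b c : E) :
    f a b (s • c) = s * f a b c := by
  rw [hf.swap_right, hf.smul_mid, hf.swap_right a c]

variable [FiniteDimensional ℂ E]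

/-- A maximizer gives further maximizers along the span of two of its entries. -/
theorem pair_eq (hf : IsContractiveSymmTrilinear f) {x y w : E} (hx : ‖x‖ = 1) (hy : ‖y‖ = 1)
    (hw : ‖w‖ = 1) (h : f w x y = 1) (a : ℂ) (v : E) :
    f v (x + a • y) (y + starRingEnd ℂ a • x) =
      ((‖x + a • y‖ ^ 2 : ℝ) : ℂ) * inner ℂ w v := by
  have h1 (v : E) : f v x w = inner ℂ y v := by
    have := hf.eq_inner (a := x) (b := w) hy
      (by rw [hx, hw, hf.rotate, hf.swap_right, h]; simp) v
    simpa [hx, hw] using this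
  have h2 (v : E) : f v y w = inner ℂ x v := by
    have := hf.eq_inner (a := y) (b := w) hx (by rw [hy, hw, hf.rotate, h]; simp) v
    simpa [hy, hw] using this
  have hn : ‖y + starRingEnd ℂ a • x‖ = ‖x + a • y‖ := by
    rw [← sq_eq_sq₀ (norm_nonneg _) (norm_nonneg _), @norm_add_sq ℂ, @norm_add_sq ℂ, norm_smul,
      norm_smul, hx, hy, inner_smul_right, inner_smul_right, ← inner_conj_symm y x, ← map_mul,
      RCLike.conj_re]
    simp
  set p := x + a • y with hp
  set q := y + starRingEnd ℂ a • x with hq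
  have h3 : f w p q = ((‖p‖ * ‖q‖ : ℝ) : ℂ) := by
    -- `h1` and `h2` make `f w p ·` the functional `⟨y, ·⟩ + a ⟨x, ·⟩ = ⟨q, ·⟩`; this is why `q`
    -- carries the conjugate of `a`.
    have h4 : f w p q = inner ℂ q q := by
      rw [hf.swap_left, hf.swap_right, hp, hf.add, hf.smul, hf.swap_left x, hf.swap_left y, h1, h2]
      conv_rhs => rw [hq, inner_add_left, inner_smul_left, Complex.conj_conj, ← hq]
    rw [h4, inner_self_eq_norm_sq_to_K, ← hn]
    push_cast
    exact sq _
  rw [hf.eq_inner hw h3, hn, sq]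

/-- The diagonal values of `f` at two entries of a maximizer. -/
theorem diag_eq (hf : IsContractiveSymmTrilinear f) {x y w : E} (hx : ‖x‖ = 1) (hy : ‖y‖ = 1)
    (hw : ‖w‖ = 1) (h : f w x y = 1) (v : E) :
    f v x x = inner ℂ y x * inner ℂ w v := by
  have h0 : f v x y = inner ℂ w v := by
    have := hf.eq_inner (a := x) (b := y) hw (by rw [hx, hy, h]; simp) v
    simpa [hx, hy] using this
  have hsq (a : ℂ) (ha : ‖a‖ = 1) :
      ‖x + a • y‖ ^ 2 = 2 + 2 * (a * starRingEnd ℂ (inner ℂ y x)).re := by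
    rw [@norm_add_sq ℂ, norm_smul, hx, hy, ha, inner_smul_right, ← inner_conj_symm x y]
    simp only [RCLike.re_to_complex]
    ring
  -- The values `1` and `i` of `a` give two independent linear equations in the unknowns `f v x x`
  -- and `f v y y`.
  have e1 := hf.pair_eq hx hy hw h 1 v
  have e2 := hf.pair_eq hx hy hw h Complex.I v
  rw [hsq _ (by simp)] at e1 e2
  simp only [hf.add_mid, hf.add_right, hf.smul_mid, hf.smul_right, hf.swap_right v y x, h0,
    Complex.conj_I, map_one, one_mul] at e1 e2
  generalize inner ℂ y x = c at e1 e2 ⊢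
  nth_rw 1 [← Complex.re_add_im c]
  simp at e1 e2
  linear_combination (1 / 2) * e1 + (Complex.I / 2) * e2 +
    (f v x x / 2 - f v y y / 2 + Complex.I / 2 * inner ℂ w v) * Complex.I_sq

/-- After normalizing `u` to `x`, the functional `f · x x` is `⟨w, ·⟩`, while `diag_eq` at the
maximizer `(x, x, w)` shows it to be a multiple of `⟨x, ·⟩`. -/
theorem exists_smul_eq_of_diag (hf : IsContractiveSymmTrilinear f) {u w : E} (hw : ‖w‖ = 1)
    (hu : u ≠ 0) (h : f w u u = ((‖u‖ ^ 2 : ℝ) : ℂ)) : ∃ c : ℂ, w = c • u := by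
  have hn : (‖u‖ : ℂ) ≠ 0 := by simpa using hu
  obtain ⟨x, hx, hux⟩ : ∃ x : E, ‖x‖ = 1 ∧ u = (‖u‖ : ℂ) • x :=
    ⟨(‖u‖ : ℂ)⁻¹ • u, by rw [norm_smul]; simp [hu], by rw [smul_smul, mul_inv_cancel₀ hn, one_smul]⟩
  have h1 : f w x x = 1 := by
    rw [hux, hf.smul_mid, hf.smul_right, ← hux] at h
    push_cast at h
    field_simp at h
    exact h
  have h2 : f x x w = 1 := by rw [hf.rotate, h1]
  have key (v : E) : inner ℂ w v = inner ℂ w x * inner ℂ x v := by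
    rw [← hf.diag_eq hx hw hx h2]
    have := hf.eq_inner (a := x) (b := x) hw (by rw [hx, h1]; simp) v
    simpa [hx] using this.symm
  refine ⟨starRingEnd ℂ (inner ℂ w x) * (‖u‖ : ℂ)⁻¹, ext_inner_right ℂ fun v => ?_⟩
  have hxu : (‖u‖ : ℂ)⁻¹ • u = x := by
    rw [inv_smul_eq_iff₀ hn, ← hux]
  rw [key, mul_smul, hxu, inner_smul_left, Complex.conj_conj]

/-- Two entries of a maximizer of a symmetric trilinear form are linearly dependent. -/
theorem exists_smul_eq (hf : IsContractiveSymmTrilinear f) {x y w : E} (hx : ‖x‖ = 1)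
    (hy : ‖y‖ = 1) (hw : ‖w‖ = 1) (h : f w x y = 1) : ∃ c : ℂ, y = c • x := by
  by_cases hu : x + y = 0
  · exact ⟨-1, by rw [neg_one_smul]; exact eq_neg_of_add_eq_zero_right hu⟩
  by_cases hm : x - y = 0
  · exact ⟨1, by rw [one_smul]; exact (sub_eq_zero.1 hm).symm⟩
  have hww : inner ℂ w w = (1 : ℂ) := by rw [inner_self_eq_norm_sq_to_K, hw]; simp
  obtain ⟨c, hc⟩ := hf.exists_smul_eq_of_diag hw hu (by
    have := hf.pair_eq hx hy hw h 1 w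
    rwa [map_one, one_smul, one_smul, add_comm y x, hww, mul_one] at this)
  -- For `a = -1` the diagonal value at `x - y` is `-‖x - y‖²`; the factor `i` in both slots
  -- corrects the sign.
  obtain ⟨c', hc'⟩ := hf.exists_smul_eq_of_diag (u := Complex.I • (x - y)) hw
    (smul_ne_zero Complex.I_ne_zero hm) (by
      have := hf.pair_eq hx hy hw h (-1) w
      rw [map_neg, map_one, neg_one_smul, neg_one_smul, hww, mul_one, ← sub_eq_add_neg,
        ← sub_eq_add_neg, ← neg_sub x y, ← neg_one_smul ℂ (x - y), hf.smul_right] at this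
      rw [hf.smul_mid, hf.smul_right, norm_smul, Complex.norm_I, one_mul, ← this]
      linear_combination f w (x - y) (x - y) * Complex.I_sq)
  have hw0 : w ≠ 0 := fun h => by simp [h] at hw
  have hc0 : c ≠ 0 := by rintro rfl; exact hw0 (by rw [hc, zero_smul])
  have hx0 : x ≠ 0 := fun h => by simp [h] at hx
  have e : (c + c' * Complex.I) • y = (c' * Complex.I - c) • x := by
    have := hc.symm.trans hc'
    rw [smul_smul] at this
    rw [← sub_eq_zero] at this ⊢
    rw [← this]
    module
  -- If this coefficient vanished, so would `c' i - c` since `x ≠ 0`, forcing `c = 0` and `w = 0`.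
  by_cases h0 : c + c' * Complex.I = 0
  · exfalso
    rw [h0, zero_smul] at e
    have := (smul_eq_zero.1 e.symm).resolve_right hx0
    exact hc0 (by linear_combination (1 / 2) * h0 - (1 / 2) * this)
  · exact ⟨(c + c' * Complex.I)⁻¹ * (c' * Complex.I - c), by
      rw [mul_smul, ← e, smul_smul, inv_mul_cancel₀ h0, one_smul]⟩

end IsContractiveSymmTrilinear

end SymmetricTrilinear

/-! ### Nearest points on complex lines. -/

section BestApproximation

/-- If `u` is nearest to `v` on its own line, then `v - u` is orthogonal to `u`. -/
theorem inner_sub_eq_zero_of_forall_norm_le {E : Type*} [NormedAddCommGroup E]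
    [InnerProductSpace ℂ E] {v u : E} (h : ∀ c : ℂ, ‖v - u‖ ≤ ‖v - c • u‖) :
    inner ℂ u (v - u) = (0 : ℂ) := by
  rcases eq_or_ne u 0 with rfl | hu
  · simp
  have hu' : inner ℂ u u ≠ (0 : ℂ) := inner_self_ne_zero.2 hu
  set c : ℂ := inner ℂ u v / inner ℂ u u with hc
  have h0 : inner ℂ u (v - c • u) = (0 : ℂ) := by
    rw [inner_sub_right, inner_smul_right, hc, div_mul_cancel₀ _ hu', sub_self]
  have h1 : ‖v - u‖ ^ 2 = ‖v - c • u‖ ^ 2 + ‖(c - 1) • u‖ ^ 2 := by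
    have : v - u = (v - c • u) + (c - 1) • u := by module
    rw [this, @norm_add_sq ℂ, inner_smul_right, ← inner_conj_symm, h0]
    simp
  have h2 : ‖(c - 1) • u‖ ^ 2 ≤ 0 := by
    have := pow_le_pow_left₀ (norm_nonneg _) (h c) 2
    linarith
  have h3 : (c - 1) • u = 0 :=
    norm_eq_zero.1 (pow_eq_zero_iff two_ne_zero |>.1 (le_antisymm h2 (sq_nonneg _)))
  rw [sub_eq_zero.1 ((smul_eq_zero.1 h3).resolve_right hu), one_smul] at h0
  exact h0

/-- If `u` is at least as close to `v` as every point of the lines through `u` and `y`, then the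
component of `v` along `y` is at most the norm of `u`. -/
theorem norm_inner_le_of_forall_norm_le {E : Type*} [NormedAddCommGroup E]
    [InnerProductSpace ℂ E] {v u y : E} (h : ∀ c : ℂ, ‖v - u‖ ≤ ‖v - c • u‖)
    (hy : ∀ c : ℂ, ‖v - u‖ ≤ ‖v - c • y‖) : ‖(inner ℂ v y : ℂ)‖ ≤ ‖u‖ * ‖y‖ := by
  rcases eq_or_ne y 0 with rfl | hy0
  · simp
  have hy' : inner ℂ y y ≠ (0 : ℂ) := inner_self_ne_zero.2 hy0
  set c : ℂ := inner ℂ y v / inner ℂ y y with hc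
  have h0 : inner ℂ y (v - c • y) = (0 : ℂ) := by
    rw [inner_sub_right, inner_smul_right, hc, div_mul_cancel₀ _ hy', sub_self]
  have h1 : ‖v‖ ^ 2 = ‖v - c • y‖ ^ 2 + ‖c • y‖ ^ 2 := by
    have : v = (v - c • y) + c • y := by module
    conv_lhs => rw [this, @norm_add_sq ℂ, inner_smul_right, ← inner_conj_symm, h0]
    simp
  have h2 : ‖v‖ ^ 2 = ‖v - u‖ ^ 2 + ‖u‖ ^ 2 := by
    have : v = (v - u) + u := by module
    conv_lhs => rw [this, @norm_add_sq ℂ, ← inner_conj_symm,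
      inner_sub_eq_zero_of_forall_norm_le h]
    simp
  have h3 : ‖c • y‖ ≤ ‖u‖ := by
    have := pow_le_pow_left₀ (norm_nonneg _) (hy c) 2
    exact abs_le_of_sq_le_sq' (by linarith) (norm_nonneg _) |>.2
  have h4 : inner ℂ y v = c * inner ℂ y y := by rw [hc, div_mul_cancel₀ _ hy']
  rw [← inner_conj_symm, RCLike.norm_conj, h4, ← inner_smul_right]
  exact (norm_inner_le_norm _ _).trans (by rw [mul_comm]; gcongr)

end BestApproximation

/-! ### From best rank-one approximations to trilinear forms. -/

section Tensor

variable {d n : ℕ}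

/-- The coordinates of a tensor, as a vector of a Euclidean space. -/
noncomputable def tensorCoord (d n : ℕ) : TensorSpace d n ≃ₗ[ℂ] EuclideanSpace ℂ (Fin d → Fin n) :=
  (tensorBasis d n).equivFun.trans (WithLp.linearEquiv 2 ℂ _).symm

theorem inner_tensorCoord (z w : TensorSpace d n) :
    inner ℂ (tensorCoord d n z) (tensorCoord d n w) = hsInner z w := by
  simp [tensorCoord, hsInner, PiLp.inner_apply, mul_comm]

theorem norm_tensorCoord (z : TensorSpace d n) : ‖tensorCoord d n z‖ = hsNorm z := by
  rw [hsNorm, ← inner_tensorCoord, @norm_eq_sqrt_re_inner ℂ]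
  rfl

theorem norm_tensorCoord_elementaryTensor (y : Fin d → EuclideanSpace ℂ (Fin n)) :
    ‖tensorCoord d n (elementaryTensor y)‖ = ∏ i, ‖y i‖ := by
  rw [← sq_eq_sq₀ (norm_nonneg _) (Finset.prod_nonneg fun _ _ => norm_nonneg _)]
  have h : ((‖tensorCoord d n (elementaryTensor y)‖ : ℂ)) ^ 2 = (∏ i, (‖y i‖ : ℂ)) ^ 2 := by
    have := @inner_self_eq_norm_sq_to_K ℂ _ _ _ _ (tensorCoord d n (elementaryTensor y))
    rw [inner_tensorCoord, hsInner_elementaryTensor] at this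
    rw [← Finset.prod_pow]
    refine this.symm.trans (Finset.prod_congr rfl fun i _ => ?_)
    exact inner_self_eq_norm_sq_to_K (𝕜 := ℂ) (y i)
  exact_mod_cast h

theorem tensorRank_smul_elementaryTensor_le [NeZero d] (c : ℂ)
    (y : Fin d → EuclideanSpace ℂ (Fin n)) : tensorRank (c • elementaryTensor y) ≤ 1 :=
  Nat.sInf_le ⟨fun _ => Function.update y 0 (c • y 0), by
    simp [elementaryTensor, MultilinearMap.map_update_smul]⟩

theorem reindex_elementaryTensor (η : Equiv.Perm (Fin d))
    (y : Fin d → EuclideanSpace ℂ (Fin n)) :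
    PiTensorProduct.reindex ℂ (fun _ : Fin d => EuclideanSpace ℂ (Fin n)) η (elementaryTensor y) =
      elementaryTensor fun i => y (η.symm i) :=
  PiTensorProduct.reindex_tprod _ _

theorem hsInner_reindex (η : Equiv.Perm (Fin d)) (z : TensorSpace d n)
    (y : Fin d → EuclideanSpace ℂ (Fin n)) :
    hsInner (PiTensorProduct.reindex ℂ (fun _ : Fin d => EuclideanSpace ℂ (Fin n)) η z)
      (elementaryTensor fun i => y (η.symm i)) = hsInner z (elementaryTensor y) := by
  induction z using PiTensorProduct.induction_on with
  | smul_tprod c g =>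
    change hsInner (PiTensorProduct.reindex ℂ _ η (c • elementaryTensor g)) _ =
      hsInner (c • elementaryTensor g) _
    rw [map_smul, reindex_elementaryTensor]
    simp only [map_smulₛₗ, LinearMap.smul_apply, hsInner_elementaryTensor]
    rw [Equiv.prod_comp η.symm fun i => inner ℂ (g i) (y i)]
  | add a b ha hb => simp only [map_add, LinearMap.add_apply, ha, hb]

theorem IsSymmetricTensor.hsInner_comp {z : TensorSpace d n} (hz : IsSymmetricTensor z)
    (η : Equiv.Perm (Fin d)) (y : Fin d → EuclideanSpace ℂ (Fin n)) :
    hsInner z (elementaryTensor fun i => y (η i)) = hsInner z (elementaryTensor y) := by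
  conv_lhs => rw [← hz η.symm]
  exact hsInner_reindex η.symm z y

theorem eq_zero_of_hsInner_elementaryTensor {z : TensorSpace d n}
    (h : ∀ y, hsInner z (elementaryTensor y) = 0) : z = 0 := by
  have h0 (w : TensorSpace d n) : hsInner z w = 0 := by
    induction w using PiTensorProduct.induction_on with
    | smul_tprod c g => rw [map_smul, show hsInner z (PiTensorProduct.tprod ℂ g) = 0 from h g,
        smul_zero]
    | add a b ha hb => rw [map_add, ha, hb, add_zero]
  rw [← (tensorCoord d n).map_eq_zero_iff, ← inner_self_eq_zero (𝕜 := ℂ), inner_tensorCoord, h0]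

theorem IsBestRankApprox.norm_sub_le [NeZero d] {z : TensorSpace d n}
    {x : Fin d → EuclideanSpace ℂ (Fin n)} (hx : IsBestRankApprox 1 z (elementaryTensor x)) (c : ℂ)
    (y : Fin d → EuclideanSpace ℂ (Fin n)) :
    ‖tensorCoord d n z - tensorCoord d n (elementaryTensor x)‖ ≤
      ‖tensorCoord d n z - c • tensorCoord d n (elementaryTensor y)‖ := by
  rw [← map_sub, ← map_smul, ← map_sub, norm_tensorCoord, norm_tensorCoord]
  exact hx.2 _ (tensorRank_smul_elementaryTensor_le c y)

theorem IsBestRankApprox.norm_hsInner_le [NeZero d] {z : TensorSpace d n}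
    {x : Fin d → EuclideanSpace ℂ (Fin n)} (hx : IsBestRankApprox 1 z (elementaryTensor x))
    (y : Fin d → EuclideanSpace ℂ (Fin n)) :
    ‖hsInner z (elementaryTensor y)‖ ≤ (∏ i, ‖x i‖) * ∏ i, ‖y i‖ := by
  rw [← inner_tensorCoord, ← norm_tensorCoord_elementaryTensor, ← norm_tensorCoord_elementaryTensor]
  exact norm_inner_le_of_forall_norm_le (fun c => hx.norm_sub_le c x) fun c => hx.norm_sub_le c y

theorem IsBestRankApprox.hsInner_eq [NeZero d] {z : TensorSpace d n}
    {x : Fin d → EuclideanSpace ℂ (Fin n)} (hx : IsBestRankApprox 1 z (elementaryTensor x)) :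
    hsInner z (elementaryTensor x) = (((∏ i, ‖x i‖) ^ 2 : ℝ) : ℂ) := by
  have h := inner_sub_eq_zero_of_forall_norm_le fun c => hx.norm_sub_le c x
  rw [inner_sub_right, inner_self_eq_norm_sq_to_K, norm_tensorCoord_elementaryTensor,
    sub_eq_zero] at h
  rw [← inner_tensorCoord, ← inner_conj_symm, h]
  simp

/-- A zero factor makes the bound in `norm_hsInner_le` zero, so `z` is orthogonal to every
elementary tensor. -/
theorem IsBestRankApprox.ne_zero [NeZero d] {z : TensorSpace d n} (hz : z ≠ 0)
    {x : Fin d → EuclideanSpace ℂ (Fin n)} (hx : IsBestRankApprox 1 z (elementaryTensor x))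
    (i : Fin d) : x i ≠ 0 := fun hi => hz <| eq_zero_of_hsInner_elementaryTensor fun y => by
  have h := hx.norm_hsInner_le y
  rw [Finset.prod_eq_zero (Finset.mem_univ i) (by rw [hi, norm_zero]), zero_mul] at h
  exact norm_le_zero_iff.1 h

/-- The family `y` with three entries replaced. -/
def updateThree (y : Fin d → EuclideanSpace ℂ (Fin n)) (i j k : Fin d)
    (a b c : EuclideanSpace ℂ (Fin n)) : Fin d → EuclideanSpace ℂ (Fin n) :=
  Function.update (Function.update (Function.update y k c) j b) i a

theorem updateThree_swap_left (y : Fin d → EuclideanSpace ℂ (Fin n)) {i j k : Fin d}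
    (hij : i ≠ j) (hik : i ≠ k) (hjk : j ≠ k) (a b c : EuclideanSpace ℂ (Fin n)) :
    (fun l => updateThree y i j k a b c (Equiv.swap i j l)) = updateThree y i j k b a c := by
  funext l
  simp only [updateThree, Function.update_apply, Equiv.swap_apply_def]
  split_ifs <;> simp_all

theorem updateThree_swap_right (y : Fin d → EuclideanSpace ℂ (Fin n)) {i j k : Fin d}
    (hij : i ≠ j) (hik : i ≠ k) (hjk : j ≠ k) (a b c : EuclideanSpace ℂ (Fin n)) :
    (fun l => updateThree y i j k a b c (Equiv.swap j k l)) = updateThree y i j k a c b := by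
  funext l
  simp only [updateThree, Function.update_apply, Equiv.swap_apply_def]
  split_ifs <;> simp_all

theorem prod_norm_update {y : Fin d → EuclideanSpace ℂ (Fin n)} {i : Fin d} (hy : ‖y i‖ = 1)
    (a : EuclideanSpace ℂ (Fin n)) :
    ∏ l, ‖Function.update y i a l‖ = ‖a‖ * ∏ l, ‖y l‖ := by
  rw [Fintype.prod_eq_mul_prod_compl i, Fintype.prod_eq_mul_prod_compl i fun l => ‖y l‖, hy,
    one_mul, Function.update_self]
  congr 1
  refine Finset.prod_congr rfl fun l hl => ?_
  rw [Function.update_of_ne (by simpa using hl)]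

theorem prod_norm_updateThree {y : Fin d → EuclideanSpace ℂ (Fin n)} (hy : ∀ i, ‖y i‖ = 1)
    {i j k : Fin d} (hij : i ≠ j) (hik : i ≠ k) (hjk : j ≠ k) (a b c : EuclideanSpace ℂ (Fin n)) :
    ∏ l, ‖updateThree y i j k a b c l‖ = ‖a‖ * ‖b‖ * ‖c‖ := by
  rw [updateThree, prod_norm_update (by simp [hij, hik, hy]), prod_norm_update (by simp [hjk, hy]),
    prod_norm_update (hy k)]
  simp [hy, mul_assoc]

theorem IsSymmetricTensor.isContractiveSymmTrilinear {z : TensorSpace d n}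
    (hz : IsSymmetricTensor z) {M : ℝ} (hM : 0 < M)
    (hzM : ∀ y, ‖hsInner z (elementaryTensor y)‖ ≤ M * ∏ i, ‖y i‖)
    {y : Fin d → EuclideanSpace ℂ (Fin n)} (hy : ∀ i, ‖y i‖ = 1)
    {i j k : Fin d} (hij : i ≠ j) (hik : i ≠ k) (hjk : j ≠ k) :
    IsContractiveSymmTrilinear fun a b c =>
      (M : ℂ)⁻¹ * hsInner z (elementaryTensor (updateThree y i j k a b c)) where
  add a a' b c := by
    simp only [updateThree, elementaryTensor, MultilinearMap.map_update_add, map_add, mul_add]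
  smul s a b c := by
    simp only [updateThree, elementaryTensor, MultilinearMap.map_update_smul, map_smul,
      smul_eq_mul]
    ring
  swap_left a b c := by
    rw [← updateThree_swap_left y hij hik hjk a b c, hz.hsInner_comp]
  swap_right a b c := by
    rw [← updateThree_swap_right y hij hik hjk a b c, hz.hsInner_comp]
  norm_le a b c := by
    rw [norm_mul, norm_inv, Complex.norm_real, Real.norm_of_nonneg hM.le, inv_mul_le_iff₀ hM,
      ← prod_norm_updateThree hy hij hik hjk a b c]
    exact hzM _

/-- Any two factors of a best rank-one approximation of a symmetric tensor are proportional. -/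
theorem IsBestRankApprox.exists_smul_eq (hd : 2 < d) {z : TensorSpace d n} (hz0 : z ≠ 0)
    (hz : IsSymmetricTensor z) {x : Fin d → EuclideanSpace ℂ (Fin n)}
    (hx : IsBestRankApprox 1 z (elementaryTensor x)) (i j : Fin d) : ∃ c : ℂ, x j = c • x i := by
  have : NeZero d := ⟨by omega⟩
  rcases eq_or_ne i j with rfl | hij
  · exact ⟨1, (one_smul _ _).symm⟩
  -- The third slot exists because `d > 2`; its factor plays the role of `w`.
  obtain ⟨k, hk⟩ : ∃ k, k ∉ ({i, j} : Finset (Fin d)) := by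
    by_contra! h
    have := Finset.card_le_card (fun k _ => h k : Finset.univ ⊆ ({i, j} : Finset (Fin d)))
    have h2 := Finset.card_le_two (a := i) (b := j)
    rw [Finset.card_fin] at this
    omega
  simp only [Finset.mem_insert, Finset.mem_singleton, not_or] at hk
  have hx0 := hx.ne_zero hz0
  have hn (l : Fin d) : (‖x l‖ : ℂ) ≠ 0 := by simpa using hx0 l
  set e : Fin d → EuclideanSpace ℂ (Fin n) := fun l => (‖x l‖ : ℂ)⁻¹ • x l with he
  have he1 (l : Fin d) : ‖e l‖ = 1 := by
    rw [he, norm_smul]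
    simp [hx0 l]
  set M : ℝ := ∏ l, ‖x l‖ with hM
  have hM0 : 0 < M := Finset.prod_pos fun l _ => norm_pos_iff.2 (hx0 l)
  have hMc : (M : ℂ) ≠ 0 := by exact_mod_cast hM0.ne'
  have hf := hz.isContractiveSymmTrilinear hM0 hx.norm_hsInner_le he1 hk.1 hk.2 hij
  obtain ⟨c, hc⟩ := hf.exists_smul_eq (he1 i) (he1 j) (he1 k) (by
    have h1 : elementaryTensor e = (M : ℂ)⁻¹ • elementaryTensor x := by
      rw [elementaryTensor, he, MultilinearMap.map_smul_univ, hM, Complex.ofReal_prod,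
        Finset.prod_inv_distrib]
      rfl
    have h2 : updateThree e k i j (e k) (e i) (e j) = e := by
      simp [updateThree]
    rw [h2, h1, map_smul, hx.hsInner_eq, ← hM, smul_eq_mul, Complex.ofReal_pow]
    field_simp)
  have hxe (l : Fin d) : x l = (‖x l‖ : ℂ) • e l := by
    rw [he, smul_smul, mul_inv_cancel₀ (hn l), one_smul]
  refine ⟨‖x j‖ * (c * (‖x i‖ : ℂ)⁻¹), ?_⟩
  rw [mul_smul, mul_smul]
  conv_lhs => rw [hxe, hc]

/-- An elementary tensor whose factors are all proportional to one vector is symmetric. -/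
theorem isSymmetricTensor_elementaryTensor_smul (c : Fin d → ℂ) (v : EuclideanSpace ℂ (Fin n)) :
    IsSymmetricTensor (elementaryTensor fun i => c i • v) := fun η => by
  rw [elementaryTensor, MultilinearMap.map_smul_univ, map_smul]
  congr 1
  exact reindex_elementaryTensor η fun _ => v

theorem IsBestRankApprox.eq_zero {x : TensorSpace d n} (hx : IsBestRankApprox 1 0 x) : x = 0 := by
  -- Zero is the empty sum of elementary tensors, hence a competitor at distance zero.
  have h := hx.2 0 ((Nat.sInf_le ⟨Fin.elim0, by simp⟩ : tensorRank _ ≤ 0).trans zero_le_one)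
  rwa [← norm_tensorCoord, ← norm_tensorCoord, sub_self, zero_sub, map_zero, map_neg, norm_neg,
    norm_zero, norm_le_zero_iff, LinearEquiv.map_eq_zero_iff] at h

end Tensor

theorem mainTheorem3 (d n : ℕ) (hd : 2 < d) (z : TensorSpace d n) (hz : IsSymmetricTensor z)
    (x : Fin d → EuclideanSpace ℂ (Fin n))
    (hx : IsBestRankApprox 1 z (elementaryTensor x)) :
    (z ≠ 0 → Module.finrank ℂ (Submodule.span ℂ (Set.range x)) = 1) ∧
      IsSymmetricTensor (elementaryTensor x) := by
  have : NeZero d := ⟨by omega⟩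
  rcases eq_or_ne z 0 with rfl | hz0
  · refine ⟨fun h => absurd rfl h, fun η => ?_⟩
    rw [hx.eq_zero, map_zero]
  choose c hc using fun i => hx.exists_smul_eq hd hz0 hz 0 i
  refine ⟨fun _ => ?_, ?_⟩
  · have hspan : Submodule.span ℂ (Set.range x) = Submodule.span ℂ {x 0} := by
      refine le_antisymm (Submodule.span_le.2 ?_) (Submodule.span_mono ?_)
      · rintro _ ⟨i, rfl⟩
        exact Submodule.mem_span_singleton.2 ⟨c i, (hc i).symm⟩
      · exact Set.singleton_subset_iff.2 ⟨0, rfl⟩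
    rw [hspan, finrank_span_singleton (hx.ne_zero hz0 0)]
  · rw [funext hc]
    exact isSymmetricTensor_elementaryTensor_smul c (x 0)
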